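/- Let $X_0$ be a complex Hilbert space, $U=\mathbb C^m$, $Y=\mathbb C^p$. Let $\mathcal A:D(\mathcal A)\subset X_0\to X_0$ and $\mathcal B:D(\mathcal A)\to U$ be linear and $C_0\in\mathcal L(X_0,Y)$, and suppose that $\dot w=\mathcal A w$, $\mathcal B w=u$, $y=C_0w$ is a boundary control system: the restriction $A_0$ of $\mathcal A$ to $D(A_0)=D(\mathcal A)\cap\ker\mathcal B$ generates a strongly continuous semigroup on $X_0$, and $\mathcal R(\mathcal B)=U$. Suppose further that * $\mathcal A=A_{\mathrm d}+A_{\mathrm{rc}}$, where $A_{\mathrm d}$, $A_{\mathrm{rc}}$ are linear operators in $X_0$ with $D(A_{\mathrm d})=D(\mathcal A)\subseteq D(A_{\mathrm{rc}})$ and, for some $\alpha,\beta\ge 0$, $\|A_{\mathrm{rc}}x\|\le\alpha\|x\|+\beta\|A_{\mathrm d}x\|$ for all $x\in D(A_{\mathrm d})$; * $\eta\ge 0$ is a real number in the resolvent set $\rho(A_0)$, and $E\in\mathcal L(U,X_0)$ satisfies $\mathcal R(E)\subset D(\mathcal A)$, $A_{\mathrm d}Eu=\eta Eu$ and $\mathcal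 B Eu=u$ for all $u\in U$. On the Hilbert space $X=X_0\times U$ with $\|(v,u)\|^2=\|v\|^2+\|u\|^2$, consider the extended operators $$A=\begin{pmatrix}A_0&A_{\mathrm{rc}}E\\0&\eta I\end{pmatrix},\quad D(A)=D(A_0)\times U,\qquad C=\begin{pmatrix}C_0&C_0E\end{pmatrix}\in\mathcal L(X,Y).$$ A pair $(F,G)$ of a linear operator $F$ in a Hilbert space $H$ and an operator $G\in\mathcal L(H,Y)$ is called exponentially detectable if there is $L\in\mathcal L(Y,H)$ such that $F+LG$, with domain $D(F)$, generates an exponentially stable strongly continuous semigroup $T$, i.e. $\|T(t)\|\le Me^{-\omega t}$ for all $t\ge 0$ with some constants $M$ and $\omega>0$. Assume that $(A_0,C_0)$ is exponentially detectable. (i) If $A_{\mathrm{rc}}E=0$ and $C_0E$ is injective, then $(A,C)$ is exponentially detectable. (ii) If $A_{\mathrm{rc}}E\neq 0$ and $\ker(\eta I-A)\cap\ker(C)=\{0\}$, then $(A,C)$ is exponentially detectable. -/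

import Mathlib

open Filter Topology

namespace BdryControl

/-! ### Strongly continuous semigroups, generators, resolvent set, detectability -/

section General

variable {X Y : Type*} [NormedAddCommGroup X] [NormedSpace ℂ X]
  [NormedAddCommGroup Y] [NormedSpace ℂ Y]

/-- `T`, restricted to `[0, ∞)`, is a strongly continuous semigroup of bounded operators on `X`.
The values of `T` at negative times play no role here or below. -/
structure IsC0Semigroup (T : ℝ → X →L[ℂ] X) : Prop where
  map_zero : T 0 = ContinuousLinearMap.id ℂ X
  map_add : ∀ s t : ℝ, 0 ≤ s → 0 ≤ t → T (s + t) = (T s).comp (T t)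
  strongly_continuous : ∀ x : X, ContinuousOn (fun t => T t x) (Set.Ici 0)

/-- `A` is the infinitesimal generator of `T`: `x ∈ D(A)` and `A x = y` if and only if
`(T h x - x) / h` converges to `y` as `h → 0+`. -/
def IsGenerator (A : X →ₗ.[ℂ] X) (T : ℝ → X →L[ℂ] X) : Prop :=
  ∀ x y : X, (x, y) ∈ A.graph ↔
    Tendsto (fun h : ℝ => ((h : ℂ)⁻¹) • (T h x - x)) (𝓝[>] (0 : ℝ)) (𝓝 y)

/-- `A` is the infinitesimal generator of a strongly continuous semigroup. -/
def GeneratesC0Semigroup (A : X →ₗ.[ℂ] X) : Prop :=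
  ∃ T : ℝ → X →L[ℂ] X, IsC0Semigroup T ∧ IsGenerator A T

/-- Exponential stability of a semigroup: `‖T t‖ ≤ M exp (-ω t)` for all `t ≥ 0`, where `ω > 0`. -/
def IsExpStable (T : ℝ → X →L[ℂ] X) : Prop :=
  ∃ M ω : ℝ, 0 < ω ∧ ∀ t : ℝ, 0 ≤ t → ‖T t‖ ≤ M * Real.exp (-ω * t)

/-- The operator `A + L C` with domain `D(A)`, for a bounded output operator `C` and a bounded
output injection `L`. -/
def outputInjection (A : X →ₗ.[ℂ] X) (C : X →L[ℂ] Y) (L : Y →L[ℂ] X) : X →ₗ.[ℂ] X :=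
  ((L.comp C : X →L[ℂ] X) : X →ₗ[ℂ] X) +ᵥ A

/-- The pair `(A, C)` is exponentially detectable: there is a bounded `L` such that `A + L C`
generates an exponentially stable strongly continuous semigroup. -/
def IsExpDetectable (A : X →ₗ.[ℂ] X) (C : X →L[ℂ] Y) : Prop :=
  ∃ L : Y →L[ℂ] X, ∃ T : ℝ → X →L[ℂ] X,
    IsC0Semigroup T ∧ IsGenerator (outputInjection A C L) T ∧ IsExpStable T

/-- `s I - A` as a linear map from `D(A)` to `X`. -/
def shifted (s : ℂ) (A : X →ₗ.[ℂ] X) : A.domain →ₗ[ℂ] X :=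
  s • A.domain.subtype - A.toFun

/-- The resolvent set `ρ(A)`: all `s` such that `s I - A : D(A) → X` has a bounded
(everywhere defined) two-sided inverse `R`. -/
def resolventSet (A : X →ₗ.[ℂ] X) : Set ℂ :=
  {s | ∃ R : X →L[ℂ] X,
    (∀ x : A.domain, R (shifted s A x) = x) ∧
    (∀ y : X, ∃ x : A.domain, R y = x ∧ shifted s A x = y)}

/-- `ker (s I - A)`, as a subspace of `X`. -/
def kerShifted (s : ℂ) (A : X →ₗ.[ℂ] X) : Submodule ℂ X :=
  (LinearMap.ker (shifted s A)).map A.domain.subtype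

/-- `F` is relatively bounded with respect to `G`. -/
def IsRelativelyBounded (F G : X →ₗ.[ℂ] X) : Prop :=
  ∃ h : G.domain ≤ F.domain, ∃ α β : ℝ, 0 ≤ α ∧ 0 ≤ β ∧
    ∀ x : G.domain, ‖F (Submodule.inclusion h x)‖ ≤ α * ‖(x : X)‖ + β * ‖G x‖

end General

/-! ### Boundary control systems and the extended system -/

/-- The restriction of `𝒜` to `D(𝒜) ∩ ker 𝓑`. -/
def restrictKer {X U : Type*} [AddCommGroup X] [Module ℂ X] [AddCommGroup U] [Module ℂ U]
    (𝒜 : X →ₗ.[ℂ] X) (𝓑 : 𝒜.domain →ₗ[ℂ] U) : X →ₗ.[ℂ] X :=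
  𝒜.domRestrict ((LinearMap.ker 𝓑).map 𝒜.domain.subtype)

variable (X₀ : Type*) [NormedAddCommGroup X₀] [InnerProductSpace ℂ X₀] (m p : ℕ)

/-- A boundary control system `w' = 𝒜 w`, `𝓑 w = u`, `y = C₀ w` on `X₀`, with input space
`U = ℂ^m` and output space `Y = ℂ^p`. -/
structure BoundaryControlSystem where
  /-- the operator `𝒜 : D(𝒜) ⊆ X₀ → X₀` -/
  𝒜 : X₀ →ₗ.[ℂ] X₀
  /-- the boundary operator `𝓑 : D(𝒜) → U` -/
  𝓑 : 𝒜.domain →ₗ[ℂ] EuclideanSpace ℂ (Fin m)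
  /-- the bounded observation operator -/
  C₀ : X₀ →L[ℂ] EuclideanSpace ℂ (Fin p)
  /-- the restriction of `𝒜` to `D(𝒜) ∩ ker 𝓑` generates a strongly continuous semigroup -/
  generates : GeneratesC0Semigroup (restrictKer 𝒜 𝓑)
  /-- the range of `𝓑` is `U` -/
  range_eq : LinearMap.range 𝓑 = ⊤

variable {X₀ m p}

namespace BoundaryControlSystem

/-- The operator `A₀`: the restriction of `𝒜` to `D(A₀) = D(𝒜) ∩ ker 𝓑`. -/
def A₀ (S : BoundaryControlSystem X₀ m p) : X₀ →ₗ.[ℂ] X₀ :=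
  restrictKer S.𝒜 S.𝓑

/-- A decomposition `𝒜 = A_d + A_rc` with `D(A_d) = D(𝒜) ⊆ D(A_rc)` and `A_rc` relatively bounded
with respect to `A_d`. -/
structure Decomposition (S : BoundaryControlSystem X₀ m p) where
  A_d : X₀ →ₗ.[ℂ] X₀
  A_rc : X₀ →ₗ.[ℂ] X₀
  domain_d : A_d.domain = S.𝒜.domain
  domain_le : S.𝒜.domain ≤ A_rc.domain
  eq_add : S.𝒜 = A_d + A_rc
  relatively_bounded : IsRelativelyBounded A_rc A_d

/-- A number `η ≥ 0` in `ρ(A₀)` and an operator `E ∈ ℒ(U, X₀)` with range in `D(𝒜)` such that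
`A_d E u = η E u` and `𝓑 E u = u` for all `u ∈ U`. -/
structure Extension {S : BoundaryControlSystem X₀ m p} (D : S.Decomposition) where
  η : ℝ
  η_nonneg : 0 ≤ η
  η_mem : (η : ℂ) ∈ resolventSet S.A₀
  E : EuclideanSpace ℂ (Fin m) →L[ℂ] X₀
  mem_domain : ∀ u, E u ∈ S.𝒜.domain
  A_d_E : ∀ u, D.A_d ⟨E u, D.domain_d.symm ▸ mem_domain u⟩ = (η : ℂ) • E u
  𝓑_E : ∀ u, S.𝓑 ⟨E u, mem_domain u⟩ = u

namespace Extension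

variable {S : BoundaryControlSystem X₀ m p} {D : S.Decomposition}

/-- The operator `A_rc E : U → X₀`. -/
def A_rcE (e : Extension D) : EuclideanSpace ℂ (Fin m) →ₗ[ℂ] X₀ :=
  D.A_rc.toFun ∘ₗ
    LinearMap.codRestrict D.A_rc.domain (e.E : EuclideanSpace ℂ (Fin m) →ₗ[ℂ] X₀)
      (fun u => D.domain_le (e.mem_domain u))

/-- The extended operator `A = [[A₀, A_rc E], [0, η I]]` on the Hilbert space `X = X₀ × U`, with
domain `D(A₀) × U`. -/
noncomputable def extA (e : Extension D) :
    WithLp 2 (X₀ × EuclideanSpace ℂ (Fin m)) →ₗ.[ℂ] WithLp 2 (X₀ × EuclideanSpace ℂ (Fin m)) where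
  domain := S.A₀.domain.comap (WithLp.fstL 2 ℂ X₀ (EuclideanSpace ℂ (Fin m))).toLinearMap
  toFun :=
    { toFun := fun x => WithLp.toLp 2
        (S.A₀ ⟨x.1.fst, x.2⟩ + e.A_rcE x.1.snd, (e.η : ℂ) • x.1.snd)
      map_add' := fun x y => by
        have h : S.A₀ ⟨(x.1 + y.1).fst, (x + y).2⟩
            = S.A₀ ⟨x.1.fst, x.2⟩ + S.A₀ ⟨y.1.fst, y.2⟩ := by
          rw [← LinearPMap.map_add]; rfl
        have h2 : (x.1 + y.1).snd = x.1.snd + y.1.snd := rfl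
        simp only [Submodule.coe_add, h, h2, map_add, smul_add, ← WithLp.toLp_add, Prod.mk_add_mk]
        congr 2
        abel
      map_smul' := fun c x => by
        have h : S.A₀ ⟨(c • x.1).fst, (c • x).2⟩ = c • S.A₀ ⟨x.1.fst, x.2⟩ := by
          rw [← LinearPMap.map_smul]; rfl
        have h2 : (c • x.1).snd = c • x.1.snd := rfl
        simp only [Submodule.coe_smul, h, h2, map_smul, RingHom.id_apply, ← WithLp.toLp_smul,
          Prod.smul_mk, smul_add, smul_comm c (e.η : ℂ)] }

/-- The extended observation operator `C = [C₀, C₀ E]` on `X = X₀ × U`. -/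
noncomputable def extC (e : Extension D) :
    WithLp 2 (X₀ × EuclideanSpace ℂ (Fin m)) →L[ℂ] EuclideanSpace ℂ (Fin p) :=
  S.C₀.comp (WithLp.fstL 2 ℂ X₀ (EuclideanSpace ℂ (Fin m))) +
    (S.C₀.comp e.E).comp (WithLp.sndL 2 ℂ X₀ (EuclideanSpace ℂ (Fin m)))

end Extension

end BoundaryControlSystem

end BdryControl

/-!
Write `A_s = A₀ + L₀ C₀` for the exponentially stable generator supplied by detectability of
`(A₀, C₀)`. The output injection for the extended pair is found by block-diagonalizing the extended
closed-loop operator with two triangular changes of coordinates, so that no spectral decomposition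
of `A₀` is needed.

The half plane `Re z > -ω`, where `ω` is the decay rate of `A_s`, lies in `ρ(A_s)`, the resolvent
being the Laplace transform of the semigroup (`IsGenerator.mem_resolventSet`). As `η ≥ 0`, there is
`P : U → X₀` with `(η - A_s) P = A_rc E + L₀ C₀ E`. After the injection `(L₀, 0)`, the coordinates
`(w, u) = (v - P u, u)` turn the extended system into `w' = A_s w`, `u' = η u`, with output
`C₀ w + G u`, `G = C₀ (P + E)`. If `G u = 0`, then `(P u, u) ∈ ker (η - A) ∩ ker C`
(`mem_kerShifted_inf_ker`), so `G` is injective as soon as this intersection is trivial. That is the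
hypothesis of (ii), and it follows from the hypotheses of (i) (`kerShifted_inf_ker_eq_bot`).

Let `K` be a left inverse of `G`, let `0 < μ < ω` and `N = (η + μ) K`. Injecting `-N y` into the
equation for `u` gives the closed loop `w' = A_s w`, `u' = -N C₀ w - μ u`. Since `-μ ∈ ρ(A_s)`, the
operator `Q = N C₀ (-μ - A_s)⁻¹` is bounded, and in the coordinates `(w, u - Q w)` the closed
loop is `diag (A_s, -μ)`. This generates an exponentially stable semigroup, and generation and
stability are invariant under isomorphisms.
-/

/-! ### The resolvent of an exponentially bounded semigroup -/

namespace BdryControl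

open MeasureTheory Set

section Resolvent

variable {X : Type*} [NormedAddCommGroup X] [NormedSpace ℂ X]

theorem continuousOn_laplaceIntegrand {T : ℝ → X →L[ℂ] X} (hT : IsC0Semigroup T) (z : ℂ) (x : X) :
    ContinuousOn (fun t : ℝ => Complex.exp (-z * t) • T t x) (Ici 0) :=
  (by fun_prop : Continuous fun t : ℝ => Complex.exp (-z * t)).continuousOn.smul
    (hT.strongly_continuous x)

theorem norm_laplaceIntegrand_le {T : ℝ → X →L[ℂ] X} {M ω : ℝ}
    (hM : ∀ t : ℝ, 0 ≤ t → ‖T t‖ ≤ M * Real.exp (-ω * t)) (z : ℂ) (x : X) {t : ℝ} (ht : 0 ≤ t) :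
    ‖Complex.exp (-z * t) • T t x‖ ≤ M * ‖x‖ * Real.exp (-(ω + z.re) * t) := by
  have h1 : ‖Complex.exp (-z * t)‖ = Real.exp (-z.re * t) := by
    simp [Complex.norm_exp]
  rw [norm_smul, h1]
  calc Real.exp (-z.re * t) * ‖T t x‖
      ≤ Real.exp (-z.re * t) * (M * Real.exp (-ω * t) * ‖x‖) := by
        gcongr
        exact (T t).le_of_opNorm_le (hM t ht) x
    _ = M * ‖x‖ * (Real.exp (-z.re * t) * Real.exp (-ω * t)) := by ring
    _ = M * ‖x‖ * Real.exp (-(ω + z.re) * t) := by rw [← Real.exp_add]; ring_nf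

theorem integrableOn_laplaceIntegrand {T : ℝ → X →L[ℂ] X} (hT : IsC0Semigroup T) {M ω : ℝ}
    (hM : ∀ t : ℝ, 0 ≤ t → ‖T t‖ ≤ M * Real.exp (-ω * t)) {z : ℂ} (hz : -ω < z.re) (x : X) :
    IntegrableOn (fun t : ℝ => Complex.exp (-z * t) • T t x) (Ioi 0) := by
  refine Integrable.mono' ((exp_neg_integrableOn_Ioi 0 (by linarith : 0 < ω + z.re)).const_mul
    (M * ‖x‖)) (((continuousOn_laplaceIntegrand hT z x).mono
      Ioi_subset_Ici_self).aestronglyMeasurable measurableSet_Ioi) ?_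
  exact (ae_restrict_iff' measurableSet_Ioi).2 (.of_forall fun t ht =>
    norm_laplaceIntegrand_le hM z x (le_of_lt ht))

/-- The Laplace transform of a semigroup of growth `M exp (-ω t)` is a bounded operator on the
half plane `Re z > -ω`. -/
theorem exists_laplaceTransform {T : ℝ → X →L[ℂ] X} (hT : IsC0Semigroup T) {M ω : ℝ}
    (hM : ∀ t : ℝ, 0 ≤ t → ‖T t‖ ≤ M * Real.exp (-ω * t)) {z : ℂ} (hz : -ω < z.re) :
    ∃ R : X →L[ℂ] X, ∀ x, R x = ∫ t in Ioi (0 : ℝ), Complex.exp (-z * t) • T t x := by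
  refine ⟨LinearMap.mkContinuous
    { toFun := fun x => ∫ t in Ioi (0 : ℝ), Complex.exp (-z * t) • T t x
      map_add' := fun x y => ?_
      map_smul' := fun c x => ?_ }
    (M * ∫ t in Ioi (0 : ℝ), Real.exp (-(ω + z.re) * t)) fun x => ?_, fun x => rfl⟩
  · simp only [map_add, smul_add]
    exact integral_add (integrableOn_laplaceIntegrand hT hM hz x)
      (integrableOn_laplaceIntegrand hT hM hz y)
  · simp only [map_smul, RingHom.id_apply, smul_comm _ c]
    exact integral_smul c _
  · have h := norm_integral_le_of_norm_le
      ((exp_neg_integrableOn_Ioi 0 (by linarith : 0 < ω + z.re)).const_mul (M * ‖x‖))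
      ((ae_restrict_iff' measurableSet_Ioi).2 (.of_forall fun t ht =>
        norm_laplaceIntegrand_le hM z x (le_of_lt ht)))
    rw [integral_const_mul] at h
    exact h.trans_eq (by ring)

/-- `T h` shifts the Laplace transform: `T h R x = exp (z h) (R x - ∫₀ʰ exp (-z t) T t x dt)`. -/
theorem semigroup_laplaceTransform [CompleteSpace X] {T : ℝ → X →L[ℂ] X} (hT : IsC0Semigroup T)
    {M ω : ℝ} (hM : ∀ t : ℝ, 0 ≤ t → ‖T t‖ ≤ M * Real.exp (-ω * t)) {z : ℂ} (hz : -ω < z.re)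
    (x : X) {h : ℝ} (hh : 0 ≤ h) :
    T h (∫ t in Ioi (0 : ℝ), Complex.exp (-z * t) • T t x) =
      Complex.exp (z * h) • ((∫ t in Ioi (0 : ℝ), Complex.exp (-z * t) • T t x) -
        ∫ t in (0 : ℝ)..h, Complex.exp (-z * t) • T t x) := by
  have hint := integrableOn_laplaceIntegrand hT hM hz x
  rw [← intervalIntegral.integral_Ioi_sub_Ioi hint hh, sub_sub_cancel,
    ← ContinuousLinearMap.integral_comp_comm _ hint, ← integral_smul]
  have key := (measurePreserving_add_right volume h).setIntegral_preimage_emb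
    (measurableEmbedding_addRight h)
    (fun t : ℝ => Complex.exp (z * h) • Complex.exp (-z * t) • T t x) (Ioi h)
  rw [← key]
  have hpre : (fun t : ℝ => t + h) ⁻¹' Ioi h = Ioi 0 := by ext; simp
  rw [hpre]
  refine setIntegral_congr_fun measurableSet_Ioi fun t ht => ?_
  have hadd : T (t + h) x = T h (T t x) := by
    rw [add_comm, hT.map_add h t hh (le_of_lt ht)]; rfl
  simp only [map_smul, hadd, smul_smul, ← Complex.exp_add]
  congr 2
  push_cast
  ring

theorem coe_shifted_apply (s : ℂ) (A : X →ₗ.[ℂ] X) (x : A.domain) :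
    shifted s A x = s • (x : X) - A x := rfl

/-- If `‖T t‖ ≤ M exp (-ω t)`, the half plane `Re z > -ω` belongs to the resolvent set of the
generator, the resolvent being the Laplace transform of `T`. -/
theorem IsGenerator.mem_resolventSet [CompleteSpace X] {A : X →ₗ.[ℂ] X} {T : ℝ → X →L[ℂ] X}
    (hT : IsC0Semigroup T) (hA : IsGenerator A T) {M ω : ℝ}
    (hM : ∀ t : ℝ, 0 ≤ t → ‖T t‖ ≤ M * Real.exp (-ω * t)) {z : ℂ} (hz : -ω < z.re) :
    z ∈ resolventSet A := by
  obtain ⟨R, hR⟩ := exists_laplaceTransform hT hM hz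
  -- `R b` is in the domain of the generator, which maps it to `z R b - b`.
  have htend (b : X) : Tendsto (fun h : ℝ => (h : ℂ)⁻¹ • (T h (R b) - R b)) (𝓝[>] 0)
      (𝓝 (z • R b - b)) := by
    have hcont := continuousOn_laplaceIntegrand hT z b
    have h1 : HasDerivWithinAt (fun h : ℝ => ∫ t in (0 : ℝ)..h, Complex.exp (-z * t) • T t b)
        b (Ioi 0) 0 := by
      have := intervalIntegral.integral_hasDerivWithinAt_right (a := 0) (b := 0)
        (f := fun t : ℝ => Complex.exp (-z * t) • T t b) (s := Ici 0) (t := Ioi 0)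
        IntervalIntegrable.refl
        ⟨Ioi 0, self_mem_nhdsWithin, (hcont.mono
          Ioi_subset_Ici_self).aestronglyMeasurable measurableSet_Ioi⟩
        ((hcont 0 self_mem_Ici).mono Ioi_subset_Ici_self)
      simpa [hT.map_zero] using this.mono Ioi_subset_Ici_self
    have h2 : HasDerivWithinAt (fun h : ℝ => Complex.exp (z * h)) z (Ioi 0) 0 := by
      have := ((((hasDerivAt_id (0 : ℝ)).ofReal_comp).const_mul z).cexp).hasDerivWithinAt
        (s := Ioi 0)
      simpa using this
    have h3 := h2.smul (h1.const_sub (R b))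
    rw [hasDerivWithinAt_iff_tendsto_slope' (by simp)] at h3
    refine (h3.congr' ?_).trans (by simp [sub_eq_add_neg, add_comm])
    filter_upwards [self_mem_nhdsWithin] with h hh
    have h4 := semigroup_laplaceTransform hT hM hz b (le_of_lt hh)
    rw [← hR] at h4
    simp only [slope_def_module, sub_zero, h4, ← Complex.ofReal_inv, Complex.coe_smul]
    simp
  refine ⟨R, fun x => ?_, fun y => ?_⟩
  · -- `R` commutes with `T`, so the difference quotient of `R x` also converges to `R (A x)`.
    have hcomm : ∀ h : ℝ, 0 ≤ h → T h (R x) = R (T h x) := fun h hh => by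
      rw [hR, hR, ← ContinuousLinearMap.integral_comp_comm _
        (integrableOn_laplaceIntegrand hT hM hz _)]
      refine setIntegral_congr_fun measurableSet_Ioi fun t ht => ?_
      have h1 := hT.map_add h t hh (le_of_lt ht)
      rw [add_comm, hT.map_add t h (le_of_lt ht) hh] at h1
      simpa using congrArg (fun S : X →L[ℂ] X => Complex.exp (-z * t) • S x) h1.symm
    have h1 := (R.continuous.tendsto _).comp ((hA x (A x)).1 (A.mem_graph x))
    have h2 : Tendsto (fun h : ℝ => (h : ℂ)⁻¹ • (T h (R x) - R x)) (𝓝[>] 0) (𝓝 (R (A x))) := by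
      refine h1.congr' ?_
      filter_upwards [self_mem_nhdsWithin] with h hh
      simp [hcomm h (le_of_lt hh)]
    rw [coe_shifted_apply, map_sub, map_smul, tendsto_nhds_unique h2 (htend x), sub_sub_cancel]
  · obtain ⟨x, hx, hx'⟩ := (LinearPMap.mem_graph_iff _).1 ((hA _ _).2 (htend y))
    refine ⟨x, hx.symm, ?_⟩
    rw [coe_shifted_apply, hx, hx', sub_sub_cancel]

end Resolvent

end BdryControl

/-! ### Semigroups under isomorphisms and direct sums -/

namespace BdryControl

section Transfer

variable {X Z : Type*} [NormedAddCommGroup X] [NormedSpace ℂ X]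
  [NormedAddCommGroup Z] [NormedSpace ℂ Z]

/-- The semigroup `Θ⁻¹ T Θ` obtained from `T` by an isomorphism `Θ`. -/
noncomputable def conjSemigroup (Θ : Z ≃L[ℂ] X) (T : ℝ → X →L[ℂ] X) (t : ℝ) : Z →L[ℂ] Z :=
  (Θ.symm : X →L[ℂ] Z).comp ((T t).comp (Θ : Z →L[ℂ] X))

theorem conjSemigroup_apply (Θ : Z ≃L[ℂ] X) (T : ℝ → X →L[ℂ] X) (t : ℝ) (x : Z) :
    conjSemigroup Θ T t x = Θ.symm (T t (Θ x)) := rfl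

theorem IsC0Semigroup.conj {T : ℝ → X →L[ℂ] X} (hT : IsC0Semigroup T) (Θ : Z ≃L[ℂ] X) :
    IsC0Semigroup (conjSemigroup Θ T) where
  map_zero := by ext x; simp [conjSemigroup_apply, hT.map_zero]
  map_add s t hs ht := by ext x; simp [conjSemigroup_apply, hT.map_add s t hs ht]
  strongly_continuous x := Θ.symm.continuous.comp_continuousOn (hT.strongly_continuous (Θ x))

theorem IsExpStable.conj {T : ℝ → X →L[ℂ] X} (hT : IsExpStable T) (Θ : Z ≃L[ℂ] X) :
    IsExpStable (conjSemigroup Θ T) := by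
  obtain ⟨M, ω, hω, hM⟩ := hT
  refine ⟨‖(Θ.symm : X →L[ℂ] Z)‖ * M * ‖(Θ : Z →L[ℂ] X)‖, ω, hω, fun t ht => ?_⟩
  calc ‖conjSemigroup Θ T t‖
      ≤ ‖(Θ.symm : X →L[ℂ] Z)‖ * ‖(T t).comp (Θ : Z →L[ℂ] X)‖ :=
        ContinuousLinearMap.opNorm_comp_le _ _
    _ ≤ ‖(Θ.symm : X →L[ℂ] Z)‖ * (M * Real.exp (-ω * t) * ‖(Θ : Z →L[ℂ] X)‖) := by
        gcongr
        refine (ContinuousLinearMap.opNorm_comp_le _ _).trans ?_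
        gcongr
        exact hM t ht
    _ = _ := by ring

/-- The generator of `Θ⁻¹ T Θ` is `Θ⁻¹ A Θ`, where `A` generates `T`. -/
theorem tendsto_conjSemigroup_iff (Θ : Z ≃L[ℂ] X) (T : ℝ → X →L[ℂ] X) (x y : Z) :
    Tendsto (fun h : ℝ => (h : ℂ)⁻¹ • (conjSemigroup Θ T h x - x)) (𝓝[>] 0) (𝓝 y) ↔
      Tendsto (fun h : ℝ => (h : ℂ)⁻¹ • (T h (Θ x) - Θ x)) (𝓝[>] 0) (𝓝 (Θ y)) := by
  rw [Θ.toHomeomorph.isInducing.tendsto_nhds_iff]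
  simp [Function.comp_def, conjSemigroup_apply]

end Transfer

section Diagonal

variable {X U : Type*} [NormedAddCommGroup X] [NormedSpace ℂ X]
  [NormedAddCommGroup U] [NormedSpace ℂ U]

/-- The semigroup `diag (T t, exp (-μ t))` on `X × U`. -/
noncomputable def diagSemigroup (U : Type*) [NormedAddCommGroup U] [NormedSpace ℂ U]
    (T : ℝ → X →L[ℂ] X) (μ : ℝ) (t : ℝ) : X × U →L[ℂ] X × U :=
  (T t).prodMap ((Real.exp (-μ * t) : ℂ) • ContinuousLinearMap.id ℂ U)

theorem diagSemigroup_apply (T : ℝ → X →L[ℂ] X) (μ t : ℝ) (x : X × U) :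
    diagSemigroup U T μ t x = (T t x.1, (Real.exp (-μ * t) : ℂ) • x.2) := rfl

theorem IsC0Semigroup.diag {T : ℝ → X →L[ℂ] X} (hT : IsC0Semigroup T) (μ : ℝ) :
    IsC0Semigroup (diagSemigroup U T μ) where
  map_zero := by ext x <;> simp [diagSemigroup_apply, hT.map_zero]
  map_add s t hs ht := by
    refine ContinuousLinearMap.ext fun x => ?_
    have h : (Real.exp (-μ * (s + t)) : ℂ) = Real.exp (-μ * s) * Real.exp (-μ * t) := by
      rw [← Complex.ofReal_mul, ← Real.exp_add, mul_add]
    rw [ContinuousLinearMap.comp_apply]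
    simp only [diagSemigroup_apply, hT.map_add s t hs ht, h, mul_smul,
      ContinuousLinearMap.comp_apply]
  strongly_continuous x := (hT.strongly_continuous x.1).prodMk
    (by fun_prop : Continuous fun t : ℝ => (Real.exp (-μ * t) : ℂ) • x.2).continuousOn

theorem IsExpStable.diag {T : ℝ → X →L[ℂ] X} (hT : IsExpStable T) {μ : ℝ} (hμ : 0 < μ) :
    IsExpStable (diagSemigroup U T μ) := by
  obtain ⟨M, ω, hω, hM⟩ := hT
  have hM0 : 0 ≤ M := by simpa using (norm_nonneg _).trans (hM 0 le_rfl)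
  refine ⟨max M 1, min ω μ, lt_min hω hμ, fun t ht => ?_⟩
  refine ContinuousLinearMap.opNorm_le_bound _ (by positivity) fun x => ?_
  rw [diagSemigroup_apply, Prod.norm_def]
  refine max_le ?_ ?_
  · calc ‖T t x.1‖ ≤ M * Real.exp (-ω * t) * ‖x.1‖ := (T t).le_of_opNorm_le (hM t ht) _
      _ ≤ max M 1 * Real.exp (-min ω μ * t) * ‖x‖ := by
        gcongr
        exacts [le_max_left _ _, min_le_left _ _, norm_fst_le x]
  · rw [norm_smul, Complex.norm_real, Real.norm_of_nonneg (Real.exp_pos _).le,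
      ← one_mul (Real.exp _)]
    gcongr
    exacts [le_max_right _ _, min_le_right _ _, norm_snd_le x]

/-- The generator of `diag (T t, exp (-μ t))` is `diag (A, -μ)`, with domain `D(A) × U`. -/
theorem tendsto_diagSemigroup_iff {A : X →ₗ.[ℂ] X} {T : ℝ → X →L[ℂ] X} (hA : IsGenerator A T)
    (μ : ℝ) (x y : X × U) :
    Tendsto (fun h : ℝ => (h : ℂ)⁻¹ • (diagSemigroup U T μ h x - x)) (𝓝[>] 0) (𝓝 y) ↔
      (x.1, y.1) ∈ A.graph ∧ y.2 = -(μ : ℂ) • x.2 := by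
  have hexp : Tendsto (fun h : ℝ => (h : ℂ)⁻¹ • ((Real.exp (-μ * h) : ℂ) • x.2 - x.2)) (𝓝[>] 0)
      (𝓝 (-(μ : ℂ) • x.2)) := by
    have h1 : HasDerivWithinAt (fun h : ℝ => Real.exp (-μ * h)) (-μ) (Set.Ioi 0) 0 := by
      have := ((hasDerivAt_id (0 : ℝ)).const_mul (-μ)).exp.hasDerivWithinAt (s := Set.Ioi 0)
      simpa using this
    rw [hasDerivWithinAt_iff_tendsto_slope' (by simp)] at h1
    have h2 := (((Complex.continuous_ofReal.tendsto _).comp h1).smul_const x.2)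
    rw [Complex.ofReal_neg] at h2
    refine h2.congr fun h => ?_
    simp only [Function.comp_apply, slope_def_field]
    push_cast
    simp [sub_smul, smul_sub, smul_smul, div_eq_inv_mul, mul_sub]
  rw [Prod.tendsto_iff, hA]
  refine and_congr_right fun _ => ⟨fun h => tendsto_nhds_unique h hexp, fun h => ?_⟩
  rw [h]
  exact hexp

end Diagonal

end BdryControl

/-! ### Output injection for the extended system -/

namespace BdryControl

section Shear

variable {X U : Type*} [NormedAddCommGroup X] [NormedSpace ℂ X]
  [NormedAddCommGroup U] [NormedSpace ℂ U]

/-- The change of coordinates `(v, u) ↦ (v - P u, u - Q (v - P u))`. -/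
noncomputable def shearEquiv (P : U →L[ℂ] X) (Q : X →L[ℂ] U) : WithLp 2 (X × U) ≃L[ℂ] X × U :=
  (WithLp.prodContinuousLinearEquiv 2 ℂ X U).trans <|
    ContinuousLinearEquiv.equivOfInverse
      ((.fst ℂ X U - P.comp (.snd ℂ X U)).prod
        (.snd ℂ X U - Q.comp (.fst ℂ X U - P.comp (.snd ℂ X U))))
      ((.fst ℂ X U + P.comp (.snd ℂ X U + Q.comp (.fst ℂ X U))).prod
        (.snd ℂ X U + Q.comp (.fst ℂ X U)))
      (fun x => by ext <;> simp) (fun x => by ext <;> simp)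

theorem shearEquiv_apply (P : U →L[ℂ] X) (Q : X →L[ℂ] U) (x : WithLp 2 (X × U)) :
    shearEquiv P Q x = (x.fst - P x.snd, x.snd - Q (x.fst - P x.snd)) := rfl

end Shear

theorem mem_graph_outputInjection {X Y : Type*} [NormedAddCommGroup X] [NormedSpace ℂ X]
    [NormedAddCommGroup Y] [NormedSpace ℂ Y] {A : X →ₗ.[ℂ] X} {C : X →L[ℂ] Y} {L : Y →L[ℂ] X}
    {x y : X} : (x, y) ∈ (outputInjection A C L).graph ↔
      ∃ h : x ∈ A.domain, L (C x) + A ⟨x, h⟩ = y := by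
  rw [LinearPMap.mem_graph_iff]
  constructor
  · rintro ⟨a, rfl, rfl⟩
    exact ⟨a.2, rfl⟩
  · rintro ⟨h, rfl⟩
    exact ⟨⟨x, h⟩, rfl, rfl⟩

namespace BoundaryControlSystem.Extension

variable {X₀ : Type*} [NormedAddCommGroup X₀] [InnerProductSpace ℂ X₀] {m p : ℕ}
  {S : BoundaryControlSystem X₀ m p} {D : S.Decomposition}

theorem mem_graph_outputInjection_extA (e : Extension D)
    {L : EuclideanSpace ℂ (Fin p) →L[ℂ] WithLp 2 (X₀ × EuclideanSpace ℂ (Fin m))}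
    {x y : WithLp 2 (X₀ × EuclideanSpace ℂ (Fin m))} :
    (x, y) ∈ (outputInjection e.extA e.extC L).graph ↔ ∃ h : x.fst ∈ S.A₀.domain,
      (L (S.C₀ (x.fst + e.E x.snd))).fst + (S.A₀ ⟨x.fst, h⟩ + e.A_rcE x.snd) = y.fst ∧
      (L (S.C₀ (x.fst + e.E x.snd))).snd + (e.η : ℂ) • x.snd = y.snd := by
  have hC : e.extC x = S.C₀ (x.fst + e.E x.snd) := (map_add S.C₀ _ _).symm
  rw [mem_graph_outputInjection, hC]
  refine exists_congr fun h => ?_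
  rw [← (WithLp.prodContinuousLinearEquiv 2 ℂ X₀ (EuclideanSpace ℂ (Fin m))).injective.eq_iff,
    Prod.ext_iff]
  rfl

/-- If `P u` solves `(η - A₀ - L₀ C₀) P u = (A_rc E + L₀ C₀ E) u` and `C₀ (P + E) u = 0`, then
`(P u, u)` lies in `ker (η - A)` and in `ker C`. -/
theorem mem_kerShifted_inf_ker (e : Extension D) {L₀ : EuclideanSpace ℂ (Fin p) →L[ℂ] X₀}
    {v : X₀} {u : EuclideanSpace ℂ (Fin m)} (hv : v ∈ S.A₀.domain)
    (h : (e.η : ℂ) • v - (L₀ (S.C₀ v) + S.A₀ ⟨v, hv⟩) = e.A_rcE u + L₀ (S.C₀ (e.E u)))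
    (hC : S.C₀ (v + e.E u) = 0) :
    WithLp.toLp 2 (v, u) ∈
      kerShifted (e.η : ℂ) e.extA ⊓ LinearMap.ker e.extC.toLinearMap := by
  have hC' : L₀ (S.C₀ v) + L₀ (S.C₀ (e.E u)) = 0 := by rw [← map_add, ← map_add, hC, map_zero]
  refine ⟨⟨⟨WithLp.toLp 2 (v, u), hv⟩, ?_, rfl⟩, (map_add S.C₀ v (e.E u)).symm.trans hC⟩
  rw [SetLike.mem_coe, LinearMap.mem_ker, coe_shifted_apply]
  refine (WithLp.prodContinuousLinearEquiv 2 ℂ X₀ (EuclideanSpace ℂ (Fin m))).injective ?_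
  refine Prod.ext ?_ (sub_self ((e.η : ℂ) • u))
  change (e.η : ℂ) • v - (S.A₀ ⟨v, hv⟩ + e.A_rcE u) = 0
  linear_combination (norm := module) h + hC'

/-- `η` is not an eigenvalue of `A₀`. -/
theorem eq_zero_of_smul_eta_eq (e : Extension D) {v : X₀} (hv : v ∈ S.A₀.domain)
    (h : (e.η : ℂ) • v = S.A₀ ⟨v, hv⟩) : v = 0 := by
  obtain ⟨R, hR, -⟩ := e.η_mem
  have h1 := hR ⟨v, hv⟩
  rwa [coe_shifted_apply, h, sub_self, map_zero, eq_comm] at h1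

/-- If `C₀ E` is injective when `A_rc E = 0`, then `ker (η - A) ∩ ker C = 0`: the eigenvectors of
`A` for `η` are `(0, u)`, because `η` is not an eigenvalue of `A₀`. -/
theorem kerShifted_inf_ker_eq_bot (e : Extension D) (hrc : e.A_rcE = 0)
    (hinj : Function.Injective (S.C₀.comp e.E)) :
    kerShifted (e.η : ℂ) e.extA ⊓ LinearMap.ker e.extC.toLinearMap = ⊥ := by
  rw [eq_bot_iff]
  rintro _ ⟨⟨x, hx, rfl⟩, hC⟩
  rw [SetLike.mem_coe, LinearMap.mem_ker, coe_shifted_apply] at hx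
  have h1 : (e.η : ℂ) • x.1.fst - (S.A₀ ⟨x.1.fst, x.2⟩ + e.A_rcE x.1.snd) = 0 :=
    congrArg WithLp.fst hx
  have hv : x.1.fst = 0 := e.eq_zero_of_smul_eta_eq x.2 (by simpa [hrc, sub_eq_zero] using h1)
  have h2 : S.C₀ x.1.fst + S.C₀ (e.E x.1.snd) = 0 := hC
  rw [hv, map_zero, zero_add] at h2
  have hu : x.1.snd = 0 := hinj (h2.trans (map_zero (S.C₀.comp e.E)).symm)
  refine (WithLp.prodContinuousLinearEquiv 2 ℂ X₀ (EuclideanSpace ℂ (Fin m))).injective ?_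
  exact Prod.ext hv hu

/-- If `ker (η - A) ∩ ker C = 0`, an output injection exists for which the closed loop is similar to
`diag (A₀ + L₀ C₀, -μ)`. -/
theorem isExpDetectable_of_kerShifted_inf_ker_eq_bot [CompleteSpace X₀] (e : Extension D)
    (hdet : IsExpDetectable S.A₀ S.C₀)
    (hker : kerShifted (e.η : ℂ) e.extA ⊓ LinearMap.ker e.extC.toLinearMap = ⊥) :
    IsExpDetectable e.extA e.extC := by
  obtain ⟨L₀, T, hT, hgen, hstab⟩ := hdet
  obtain ⟨M, ω, hω, hM⟩ := id hstab
  have hη := e.η_nonneg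
  obtain ⟨R, -, hR⟩ := hgen.mem_resolventSet hT hM (z := (e.η : ℂ)) (by simp; linarith)
  -- Any decay rate `μ ∈ (0, ω)` of the second component keeps `-μ` in the resolvent set.
  set μ : ℝ := ω / 2 with hμ
  obtain ⟨R', hR', -⟩ := hgen.mem_resolventSet hT hM (z := ((-μ : ℝ) : ℂ)) (by simp; linarith)
  let P : EuclideanSpace ℂ (Fin m) →L[ℂ] X₀ :=
    R.comp (LinearMap.toContinuousLinearMap e.A_rcE + (L₀.comp S.C₀).comp e.E)
  have hP (u : EuclideanSpace ℂ (Fin m)) : ∃ h : P u ∈ S.A₀.domain,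
      (e.η : ℂ) • P u - (L₀ (S.C₀ (P u)) + S.A₀ ⟨P u, h⟩) =
        e.A_rcE u + L₀ (S.C₀ (e.E u)) := by
    obtain ⟨⟨x, hx⟩, hPx, hx'⟩ := hR (e.A_rcE u + L₀ (S.C₀ (e.E u)))
    have hPx : P u = x := hPx
    subst hPx
    exact ⟨hx, hx'⟩
  let G : EuclideanSpace ℂ (Fin m) →ₗ[ℂ] EuclideanSpace ℂ (Fin p) :=
    (S.C₀.comp (P + e.E)).toLinearMap
  have hG : LinearMap.ker G = ⊥ := by
    refine LinearMap.ker_eq_bot'.2 fun u hu => ?_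
    obtain ⟨h, hPu⟩ := hP u
    have := e.mem_kerShifted_inf_ker h hPu hu
    rw [hker, Submodule.mem_bot] at this
    exact congrArg WithLp.snd this
  obtain ⟨K, hK⟩ := G.exists_leftInverse_of_injective hG
  replace hK (u : EuclideanSpace ℂ (Fin m)) : K (S.C₀ (P u + e.E u)) = u := LinearMap.congr_fun hK u
  let N : EuclideanSpace ℂ (Fin p) →L[ℂ] EuclideanSpace ℂ (Fin m) :=
    ((e.η + μ : ℝ) : ℂ) • LinearMap.toContinuousLinearMap K
  have hN (u : EuclideanSpace ℂ (Fin m)) : N (S.C₀ (P u + e.E u)) = ((e.η + μ : ℝ) : ℂ) • u :=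
    congrArg (((e.η + μ : ℝ) : ℂ) • ·) (hK u)
  let Q : X₀ →L[ℂ] EuclideanSpace ℂ (Fin m) := (N.comp S.C₀).comp R'
  have hQ (w : X₀) (hw : w ∈ S.A₀.domain) :
      Q (((-μ : ℝ) : ℂ) • w - (L₀ (S.C₀ w) + S.A₀ ⟨w, hw⟩)) = N (S.C₀ w) :=
    congrArg (fun z => N (S.C₀ z)) (hR' ⟨w, hw⟩)
  let Θ := shearEquiv P Q
  -- `L y` is the injection `(L₀ y, -N y)` of the coordinates `(w, u)`, written for `v = w + P u`.
  let L : EuclideanSpace ℂ (Fin p) →L[ℂ] WithLp 2 (X₀ × EuclideanSpace ℂ (Fin m)) :=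
    (WithLp.prodContinuousLinearEquiv 2 ℂ X₀
      (EuclideanSpace ℂ (Fin m))).symm.toContinuousLinearMap.comp ((L₀ - P.comp N).prod (-N))
  refine ⟨L, conjSemigroup Θ (diagSemigroup (EuclideanSpace ℂ (Fin m)) T μ),
    (hT.diag μ).conj Θ, fun x y => ?_, (hstab.diag (half_pos hω)).conj Θ⟩
  rw [tendsto_conjSemigroup_iff, tendsto_diagSemigroup_iff hgen, e.mem_graph_outputInjection_extA,
    mem_graph_outputInjection]
  simp only [Θ, shearEquiv_apply]
  set v := x.fst
  set u := x.snd
  obtain ⟨hPu, hPeq⟩ := hP u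
  have hLf : (L (S.C₀ (v + e.E u))).fst =
      L₀ (S.C₀ (v + e.E u)) - P (N (S.C₀ (v + e.E u))) := rfl
  have hLs : (L (S.C₀ (v + e.E u))).snd = -N (S.C₀ (v + e.E u)) := rfl
  rw [hLf, hLs]
  have hNv : N (S.C₀ (v + e.E u)) = N (S.C₀ (v - P u)) + ((e.η + μ : ℝ) : ℂ) • u := by
    rw [← hN, ← map_add, ← map_add]; congr 2; abel
  have hdom : v - P u ∈ S.A₀.domain ↔ v ∈ S.A₀.domain :=
    Submodule.sub_mem_iff_left _ hPu
  rw [← exists_and_right]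
  suffices key : ∀ (hv : v ∈ S.A₀.domain) (hw : v - P u ∈ S.A₀.domain),
      (L₀ (S.C₀ (v + e.E u)) - P (N (S.C₀ (v + e.E u))) + (S.A₀ ⟨v, hv⟩ + e.A_rcE u) = y.fst ∧
        -N (S.C₀ (v + e.E u)) + (e.η : ℂ) • u = y.snd) ↔
      (L₀ (S.C₀ (v - P u)) + S.A₀ ⟨v - P u, hw⟩ = y.fst - P y.snd ∧
        y.snd - Q (y.fst - P y.snd) = -(μ : ℂ) • (u - Q (v - P u))) from
    ⟨fun ⟨hv, h⟩ => ⟨hdom.2 hv, (key hv _).1 h⟩, fun ⟨hw, h⟩ => ⟨hdom.1 hw, (key _ hw).2 h⟩⟩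
  intro hv hw
  have hsub : S.A₀ ⟨v - P u, hw⟩ = S.A₀ ⟨v, hv⟩ - S.A₀ ⟨P u, hPu⟩ := by
    rw [← LinearPMap.map_sub]; rfl
  have hQw := hQ _ hw
  set w := v - P u with hw_def
  set a := L₀ (S.C₀ w) + S.A₀ ⟨w, hw⟩ with ha
  set s := -N (S.C₀ (v + e.E u)) + (e.η : ℂ) • u with hs
  -- `s` and `a + P s` are the components of the closed loop; `a` is `A_s w`.
  have hs' : s = Q a - (μ : ℂ) • (u - Q w) := by
    rw [map_sub, map_smul] at hQw
    rw [hs, hNv, ← hQw]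
    push_cast
    module
  have hfst : L₀ (S.C₀ (v + e.E u)) - P (N (S.C₀ (v + e.E u))) +
      (S.A₀ ⟨v, hv⟩ + e.A_rcE u) = a + P s := by
    rw [hs, ha, hsub, hw_def]
    simp only [map_add, map_sub, map_neg, map_smul]
    linear_combination (norm := module) -hPeq
  rw [hfst, neg_smul]
  constructor
  · rintro ⟨h1, h2⟩
    rw [← h1, ← h2, add_sub_cancel_right]
    exact ⟨rfl, by rw [hs']; abel⟩
  · rintro ⟨h1, h2⟩
    rw [← h1] at h2
    have h3 : s = y.snd := by rw [hs', sub_eq_iff_eq_add.1 h2]; abel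
    exact ⟨by rw [h1, h3]; abel, h3⟩

end BoundaryControlSystem.Extension

end BdryControl

theorem lemma3p2 {X₀ : Type*} [NormedAddCommGroup X₀] [InnerProductSpace ℂ X₀] [CompleteSpace X₀]
    {m p : ℕ} (S : BdryControl.BoundaryControlSystem X₀ m p) (D : S.Decomposition)
    (e : BdryControl.BoundaryControlSystem.Extension D)
    (hdet : BdryControl.IsExpDetectable S.A₀ S.C₀) :
    (e.A_rcE = 0 → Function.Injective (S.C₀.comp e.E) →
      BdryControl.IsExpDetectable e.extA e.extC) ∧
    (e.A_rcE ≠ 0 → BdryControl.kerShifted (e.η : ℂ) e.extA ⊓ LinearMap.ker e.extC.toLinearMap = ⊥ →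
      BdryControl.IsExpDetectable e.extA e.extC) := by
  refine ⟨fun hrc hinj => ?_, fun _ hker => ?_⟩
  · exact e.isExpDetectable_of_kerShifted_inf_ker_eq_bot hdet (e.kerShifted_inf_ker_eq_bot hrc hinj)
  · exact e.isExpDetectable_of_kerShifted_inf_ker_eq_bot hdet hker
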